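/- Let $N\ge 1$ be an integer and consider the differential equation $$H'(r)+\frac{N-1}{r}\,H(r)=-1+H(r)^2,\qquad r>0. \tag{E}$$ Then (E) has a unique positive solution $h_N:(0,+\infty)\to(0,+\infty)$ defined on all of $(0,+\infty)$. If $N\ge 2$, this solution is strictly decreasing and satisfies $$h_N(r)=1+\frac{N-1}{2r}+\mathcal O\Bigl(\frac1{r^2}\Bigr)\quad\text{as } r\to+\infty,$$ and, as $r\to 0^+$, $$h_N(r)\sim\frac{1}{r\log(1/r)}\ \text{ if } N=2,\qquad h_N(r)\sim\frac{N-2}{r}\ \text{ if } N\ge 3.$$ Moreover, let $H$ be a solution of (E) on an interval $J\subset(0,+\infty)$ which cannot be continued as a solution to the right of $J$, and let $r_1\in J$. If $H(r_1)>h_N(r_1)$, then $H$ blows up in finite time: $R=\sup J<+\infty$ and $H(r)\to+\infty$ as $r\to R^-$. If $H(r_1)<h_N(r_1)$, then $H$ cannot stay positive: there is $r\in J$ with $r>r_1$ and $H(r)<0$. Finally, $$h_N(r)=\frac{K_{N/2}(r)}{K_{N/2-1}(r)},\qquad r>0,$$ where $K_\nu(r)=\int_0^\infty e^{-r\cosh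 t}\cosh(\nu t)\,dt$ is the modified Bessel function of the second kind of order $\nu\in\mathbb R$. In particular $h_1(r)=1$ and $h_3(r)=1+1/r$ for all $r>0$. -/

import Mathlib

open Set Filter Topology Asymptotics MeasureTheory

/-- `H` solves `H'(r) + (N-1)/r * H(r) = -1 + H(r)^2` at every point `r` of `J`, where `J` is meant
to be an interval contained in `(0, ∞)`. The derivative is taken within `J`: it is the usual
derivative at interior points, and one-sided at an endpoint that belongs to `J`. -/
def IsRiccatiSolutionOn (N : ℕ) (H : ℝ → ℝ) (J : Set ℝ) : Prop :=
  ∀ r ∈ J, HasDerivWithinAt H (-1 + H r ^ 2 - ((N : ℝ) - 1) / r * H r) J r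

/-- `h` is a solution of the equation on the whole of `(0, ∞)` with values in `(0, ∞)`. -/
def IsPositiveRiccatiSolution (N : ℕ) (h : ℝ → ℝ) : Prop :=
  IsRiccatiSolutionOn N h (Ioi 0) ∧ ∀ r : ℝ, 0 < r → 0 < h r

/-- `H` is a solution on the interval `J ⊆ (0, ∞)` which is maximal in the forward direction: no
solution on a larger interval `J' ⊆ (0, ∞)` that agrees with `H` on `J` goes beyond `J` to the
right. -/
def IsForwardMaximalRiccatiSolution (N : ℕ) (H : ℝ → ℝ) (J : Set ℝ) : Prop :=
  J.OrdConnected ∧ J ⊆ Ioi 0 ∧ IsRiccatiSolutionOn N H J ∧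
    ∀ (G : ℝ → ℝ) (J' : Set ℝ), J'.OrdConnected → J' ⊆ Ioi 0 → J ⊆ J' → EqOn G H J →
      IsRiccatiSolutionOn N G J' → ∀ x ∈ J', ∃ y ∈ J, x ≤ y

/-- The modified Bessel function of the second kind `K_ν(r)` for real order `ν` and `r > 0`:
`K_ν(r) = ∫_0^∞ exp(-r cosh t) cosh(ν t) dt`. -/
noncomputable def modifiedBesselK (ν r : ℝ) : ℝ :=
  ∫ t in Ioi (0 : ℝ), Real.exp (-r * Real.cosh t) * Real.cosh (ν * t)

/-! The solution is h = `besselRatio N`: the derivative formula and the three-term recurrence for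
K_ν turn the quotient rule into (E). Knowing one solution of a Riccati equation gives all the
others. With E = `besselWeight N`, which satisfies E' = (2h - (N-1)/r) E, they are H = h + E / (C -
∫E), the integral starting at r₁ (`sub_besselRatio_mul_eq`). If H > h at r₁ then C > 0. Since ∫E
diverges, the denominator vanishes at a finite R, where H blows up. If H < h then C < 0 and H exists
on all of [r₁, ∞). Were it nonnegative there, H - h would be bounded below and yet decrease at a
linear rate, which is absurd. Both alternatives exclude a second positive global solution. The same
forward instability (`nonneg_of_deriv_le_mul`) turns the bounds 1 ≤ h ≤ 2 near infinity into
monotonicity and the expansion there. Near 0, the recurrence traps h when N ≥ 3, and 1/(r h) + log r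
stays bounded when N = 2. -/

/-! ### Bessel functions K_ν: convergence, derivative, recurrence. -/

theorem exp_neg_mul_cosh_mul_exp_le {r : ℝ} (hr : 0 < r) (ν : ℝ) {t : ℝ} (ht : 0 ≤ t) :
    Real.exp (-r * Real.cosh t) * Real.exp (ν * t) ≤
      Real.exp ((ν + 1) ^ 2 / r) * Real.exp (-1 * t) := by
  rw [← Real.exp_add, ← Real.exp_add, Real.exp_le_exp]
  have h1 : t ^ 2 / 4 ≤ Real.cosh t := by
    rw [Real.cosh_eq]
    linarith [Real.quadratic_le_exp_of_nonneg ht, Real.exp_pos (-t)]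
  have h2 : r * (t ^ 2 / 4) ≤ r * Real.cosh t := by gcongr
  -- Complete the square in t; this is where the constant (ν + 1)² / r comes from.
  have h3 : 0 ≤ (ν + 1) ^ 2 / r - (ν + 1) * t + r * (t ^ 2 / 4) := by
    have : (ν + 1) ^ 2 / r - (ν + 1) * t + r * (t ^ 2 / 4) = (ν + 1 - r * t / 2) ^ 2 / r := by
      field_simp
      ring
    rw [this]
    positivity
  linarith

theorem abs_sinh_le_exp_and_cosh_le_exp (ν : ℝ) {t : ℝ} (ht : 0 ≤ t) :
    |Real.sinh (ν * t)| ≤ Real.exp (|ν| * t) ∧ Real.cosh (ν * t) ≤ Real.exp (|ν| * t) := by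
  have h1 : Real.exp (ν * t) ≤ Real.exp (|ν| * t) :=
    Real.exp_le_exp.2 (mul_le_mul_of_nonneg_right (le_abs_self ν) ht)
  have h2 : Real.exp (-(ν * t)) ≤ Real.exp (|ν| * t) := by
    rw [← neg_mul]
    exact Real.exp_le_exp.2 (mul_le_mul_of_nonneg_right (neg_le_abs ν) ht)
  have h3 := Real.exp_pos (ν * t)
  have h4 := Real.exp_pos (-(ν * t))
  rw [Real.sinh_eq, Real.cosh_eq, abs_le]
  refine ⟨⟨?_, ?_⟩, ?_⟩ <;> linarith

theorem integrableOn_besselK_integrand (ν : ℝ) {r : ℝ} (hr : 0 < r) :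
    IntegrableOn (fun t => Real.exp (-r * Real.cosh t) * Real.cosh (ν * t)) (Ioi 0) := by
  refine integrable_of_isBigO_exp_neg one_pos (by fun_prop) ?_
  refine IsBigO.of_bound (Real.exp ((|ν| + 1) ^ 2 / r)) ?_
  filter_upwards [eventually_ge_atTop 0] with t ht
  rw [Real.norm_of_nonneg (by positivity), Real.norm_of_nonneg (by positivity)]
  exact (mul_le_mul_of_nonneg_left (abs_sinh_le_exp_and_cosh_le_exp ν ht).2 (Real.exp_pos _).le).trans
    (exp_neg_mul_cosh_mul_exp_le hr _ ht)

theorem modifiedBesselK_pos (ν : ℝ) {r : ℝ} (hr : 0 < r) : 0 < modifiedBesselK ν r := by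
  refine (setIntegral_pos_iff_support_of_nonneg_ae
    (Eventually.of_forall fun t => by positivity) (integrableOn_besselK_integrand ν hr)).2 ?_
  have : Function.support (fun t => Real.exp (-r * Real.cosh t) * Real.cosh (ν * t)) = univ :=
    eq_univ_of_forall fun t => ne_of_gt (by positivity)
  rw [this, univ_inter, Real.volume_Ioi]
  exact ENNReal.zero_lt_top

theorem modifiedBesselK_neg (ν r : ℝ) : modifiedBesselK (-ν) r = modifiedBesselK ν r := by
  simp only [modifiedBesselK, neg_mul, Real.cosh_neg]

theorem modifiedBesselK_le_of_abs_le {μ ν : ℝ} (h : |μ| ≤ |ν|) {r : ℝ} (hr : 0 < r) :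
    modifiedBesselK μ r ≤ modifiedBesselK ν r := by
  refine setIntegral_mono_on (integrableOn_besselK_integrand μ hr)
    (integrableOn_besselK_integrand ν hr) measurableSet_Ioi fun t _ => ?_
  refine mul_le_mul_of_nonneg_left (Real.cosh_le_cosh.2 ?_) (Real.exp_pos _).le
  rw [abs_mul, abs_mul]
  gcongr

theorem cosh_mul_cosh_eq_half_add (x y : ℝ) :
    Real.cosh x * Real.cosh y = (Real.cosh (y - x) + Real.cosh (y + x)) / 2 := by
  rw [Real.cosh_add, Real.cosh_sub]
  ring

theorem cosh_mul_besselK_integrand (ν r t : ℝ) :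
    Real.cosh t * (Real.exp (-r * Real.cosh t) * Real.cosh (ν * t)) =
      (Real.exp (-r * Real.cosh t) * Real.cosh ((ν - 1) * t) +
        Real.exp (-r * Real.cosh t) * Real.cosh ((ν + 1) * t)) / 2 := by
  rw [mul_left_comm, cosh_mul_cosh_eq_half_add, sub_mul, add_mul, one_mul]
  ring

theorem integrableOn_cosh_mul_besselK_integrand (ν : ℝ) {r : ℝ} (hr : 0 < r) :
    IntegrableOn (fun t => Real.cosh t * (Real.exp (-r * Real.cosh t) * Real.cosh (ν * t)))
      (Ioi 0) := by
  simp only [cosh_mul_besselK_integrand]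
  exact ((integrableOn_besselK_integrand _ hr).add
    (integrableOn_besselK_integrand _ hr)).div_const 2

theorem integral_cosh_mul_besselK_integrand (ν : ℝ) {r : ℝ} (hr : 0 < r) :
    ∫ t in Ioi (0 : ℝ), Real.cosh t * (Real.exp (-r * Real.cosh t) * Real.cosh (ν * t)) =
      (modifiedBesselK (ν - 1) r + modifiedBesselK (ν + 1) r) / 2 := by
  simp only [cosh_mul_besselK_integrand]
  rw [integral_div, integral_add (integrableOn_besselK_integrand _ hr)
    (integrableOn_besselK_integrand _ hr)]
  rfl

theorem hasDerivAt_modifiedBesselK (ν : ℝ) {r : ℝ} (hr : 0 < r) :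
    HasDerivAt (modifiedBesselK ν)
      (-((modifiedBesselK (ν - 1) r + modifiedBesselK (ν + 1) r) / 2)) r := by
  rw [← integral_cosh_mul_besselK_integrand ν hr, ← integral_neg]
  refine (hasDerivAt_integral_of_dominated_loc_of_deriv_le
    (F := fun x t => Real.exp (-x * Real.cosh t) * Real.cosh (ν * t))
    (F' := fun x t => -(Real.cosh t * (Real.exp (-x * Real.cosh t) * Real.cosh (ν * t))))
    (Ioi_mem_nhds (half_lt_self hr)) ?_ (integrableOn_besselK_integrand ν hr) ?_
    (Eventually.of_forall fun t x hx => ?_)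
    (integrableOn_cosh_mul_besselK_integrand ν (half_pos hr))
    (Eventually.of_forall fun t x hx => ?_)).2
  · exact Eventually.of_forall fun x => Continuous.aestronglyMeasurable (by fun_prop)
  · exact Continuous.aestronglyMeasurable (by fun_prop)
  · have hx' : r / 2 < x := hx
    rw [norm_neg, Real.norm_of_nonneg (by positivity)]
    gcongr
  · have h1 : HasDerivAt (fun x : ℝ => -x * Real.cosh t) (-1 * Real.cosh t) x :=
      (hasDerivAt_neg x).mul_const _
    refine (h1.exp.mul_const (Real.cosh (ν * t))).congr_deriv ?_
    ring

theorem tendsto_exp_neg_mul_cosh_mul_sinh (ν : ℝ) {r : ℝ} (hr : 0 < r) :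
    Tendsto (fun t => Real.exp (-r * Real.cosh t) * Real.sinh (ν * t)) atTop (𝓝 0) := by
  refine squeeze_zero_norm' (a := fun t => Real.exp ((|ν| + 1) ^ 2 / r) * Real.exp (-1 * t)) ?_ ?_
  · filter_upwards [eventually_ge_atTop 0] with t ht
    rw [norm_mul, Real.norm_of_nonneg (Real.exp_pos _).le, Real.norm_eq_abs]
    exact (mul_le_mul_of_nonneg_left (abs_sinh_le_exp_and_cosh_le_exp ν ht).1 (Real.exp_pos _).le).trans
      (exp_neg_mul_cosh_mul_exp_le hr _ ht)
  · have : Tendsto (fun t : ℝ => Real.exp (-1 * t)) atTop (𝓝 0) := by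
      simpa only [neg_mul, one_mul] using Real.tendsto_exp_neg_atTop_nhds_zero
    simpa using this.const_mul (Real.exp ((|ν| + 1) ^ 2 / r))

/-- Integrate the derivative of exp(-r cosh t) sinh(νt) over (0, ∞): both boundary terms vanish. -/
theorem modifiedBesselK_add_one (ν : ℝ) {r : ℝ} (hr : 0 < r) :
    modifiedBesselK (ν + 1) r = modifiedBesselK (ν - 1) r + 2 * ν / r * modifiedBesselK ν r := by
  have hd : ∀ t ∈ Ici (0 : ℝ),
      HasDerivAt (fun t => Real.exp (-r * Real.cosh t) * Real.sinh (ν * t))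
        (ν * (Real.exp (-r * Real.cosh t) * Real.cosh (ν * t)) -
          r / 2 * (Real.exp (-r * Real.cosh t) * Real.cosh ((ν + 1) * t) -
            Real.exp (-r * Real.cosh t) * Real.cosh ((ν - 1) * t))) t := by
    intro t _
    have h1 : HasDerivAt (fun t : ℝ => -r * Real.cosh t) (-r * Real.sinh t) t :=
      (Real.hasDerivAt_cosh t).const_mul _
    have h2 : HasDerivAt (fun t : ℝ => ν * t) ν t := by
      simpa using (hasDerivAt_id t).const_mul ν
    refine (h1.exp.mul h2.sinh).congr_deriv ?_
    rw [sub_mul, add_mul, one_mul, Real.cosh_add, Real.cosh_sub]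
    ring
  have i0 := (integrableOn_besselK_integrand ν hr).const_mul ν
  have i1 := ((integrableOn_besselK_integrand (ν + 1) hr).sub
    (integrableOn_besselK_integrand (ν - 1) hr)).const_mul (r / 2)
  have h := integral_Ioi_of_hasDerivAt_of_tendsto' hd (i0.sub i1)
    (tendsto_exp_neg_mul_cosh_mul_sinh ν hr)
  simp only [Pi.sub_apply] at i1
  rw [integral_sub i0 i1, integral_const_mul, integral_const_mul,
    integral_sub (integrableOn_besselK_integrand _ hr) (integrableOn_besselK_integrand _ hr)] at h
  change ν * modifiedBesselK ν r -
    r / 2 * (modifiedBesselK (ν + 1) r - modifiedBesselK (ν - 1) r) = _ at h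
  rw [mul_zero, Real.sinh_zero, mul_zero, sub_zero] at h
  field_simp
  linarith

/-! ### The Riccati equation for the Bessel ratio, and elementary bounds. -/

/-- The ratio `K_{n/2} / K_{n/2-1}` of modified Bessel functions. -/
noncomputable def besselRatio (n r : ℝ) : ℝ :=
  modifiedBesselK (n / 2) r / modifiedBesselK (n / 2 - 1) r

theorem modifiedBesselK_half_add_one (n : ℝ) {r : ℝ} (hr : 0 < r) :
    modifiedBesselK (n / 2 + 1) r =
      modifiedBesselK (n / 2 - 1) r + n / r * modifiedBesselK (n / 2) r := by
  rw [modifiedBesselK_add_one _ hr, mul_div_cancel₀ n two_ne_zero]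

theorem modifiedBesselK_half_sub_two (n : ℝ) {r : ℝ} (hr : 0 < r) :
    modifiedBesselK (n / 2) r =
      modifiedBesselK (n / 2 - 2) r + (n - 2) / r * modifiedBesselK (n / 2 - 1) r := by
  have h := modifiedBesselK_add_one (n / 2 - 1) hr
  rw [sub_add_cancel, show n / 2 - 1 - 1 = n / 2 - 2 by ring,
    show 2 * (n / 2 - 1) = n - 2 by ring] at h
  exact h

theorem hasDerivAt_modifiedBesselK_half (n : ℝ) {r : ℝ} (hr : 0 < r) :
    HasDerivAt (modifiedBesselK (n / 2))
      (-modifiedBesselK (n / 2 - 1) r - n / (2 * r) * modifiedBesselK (n / 2) r) r := by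
  refine (hasDerivAt_modifiedBesselK (n / 2) hr).congr_deriv ?_
  rw [modifiedBesselK_half_add_one n hr]
  field_simp
  ring

theorem hasDerivAt_modifiedBesselK_half_sub_one (n : ℝ) {r : ℝ} (hr : 0 < r) :
    HasDerivAt (modifiedBesselK (n / 2 - 1))
      (-modifiedBesselK (n / 2) r + (n - 2) / (2 * r) * modifiedBesselK (n / 2 - 1) r) r := by
  refine (hasDerivAt_modifiedBesselK (n / 2 - 1) hr).congr_deriv ?_
  rw [sub_add_cancel, show n / 2 - 1 - 1 = n / 2 - 2 by ring, modifiedBesselK_half_sub_two n hr]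
  field_simp
  ring

theorem hasDerivAt_besselRatio (n : ℝ) {r : ℝ} (hr : 0 < r) :
    HasDerivAt (besselRatio n)
      (-1 + besselRatio n r ^ 2 - (n - 1) / r * besselRatio n r) r := by
  have hK := (modifiedBesselK_pos (n / 2 - 1) hr).ne'
  refine ((hasDerivAt_modifiedBesselK_half n hr).fun_div
    (hasDerivAt_modifiedBesselK_half_sub_one n hr) hK).congr_deriv ?_
  rw [besselRatio]
  generalize modifiedBesselK (n / 2 - 1) r = b at hK ⊢
  field_simp
  ring

theorem continuousOn_besselRatio (n : ℝ) : ContinuousOn (besselRatio n) (Ioi 0) :=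
  fun _ hr => (hasDerivAt_besselRatio n hr).continuousAt.continuousWithinAt

theorem one_le_besselRatio {n : ℝ} (hn : 1 ≤ n) {r : ℝ} (hr : 0 < r) : 1 ≤ besselRatio n r := by
  rw [besselRatio, one_le_div (modifiedBesselK_pos _ hr)]
  refine modifiedBesselK_le_of_abs_le ?_ hr
  rw [abs_of_nonneg (by linarith : 0 ≤ n / 2), abs_le]
  constructor <;> linarith

/-- Since cosh t ≥ 1, K_ν is at most the mean of K_{ν-1} and K_{ν+1}; the recurrence eliminates
K_{ν+1}, and n / r ≤ 1 lets half of K_ν be absorbed. -/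
theorem besselRatio_le_two {n : ℝ} (hn : 1 ≤ n) {r : ℝ} (hr : n ≤ r) : besselRatio n r ≤ 2 := by
  have hr0 : 0 < r := by linarith
  rw [besselRatio, div_le_iff₀ (modifiedBesselK_pos _ hr0)]
  have h1 : modifiedBesselK (n / 2) r ≤
      (modifiedBesselK (n / 2 - 1) r + modifiedBesselK (n / 2 + 1) r) / 2 := by
    rw [← integral_cosh_mul_besselK_integrand _ hr0]
    exact setIntegral_mono_on (integrableOn_besselK_integrand _ hr0)
      (integrableOn_cosh_mul_besselK_integrand _ hr0) measurableSet_Ioi fun t _ =>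
        le_mul_of_one_le_left (by positivity) (Real.one_le_cosh t)
  rw [modifiedBesselK_half_add_one n hr0] at h1
  have h2 : n / r * modifiedBesselK (n / 2) r ≤ 1 * modifiedBesselK (n / 2) r :=
    mul_le_mul_of_nonneg_right ((div_le_one hr0).2 hr) (modifiedBesselK_pos _ hr0).le
  linarith

theorem div_le_besselRatio (n : ℝ) {r : ℝ} (hr : 0 < r) : (n - 2) / r ≤ besselRatio n r := by
  rw [besselRatio, le_div_iff₀ (modifiedBesselK_pos _ hr), modifiedBesselK_half_sub_two n hr]
  linarith [modifiedBesselK_pos (n / 2 - 2) hr]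

theorem besselRatio_le_one_add_div {n : ℝ} (hn : 3 ≤ n) {r : ℝ} (hr : 0 < r) :
    besselRatio n r ≤ 1 + (n - 2) / r := by
  rw [besselRatio, div_le_iff₀ (modifiedBesselK_pos _ hr), modifiedBesselK_half_sub_two n hr,
    add_mul, one_mul]
  gcongr ?_ + _
  refine modifiedBesselK_le_of_abs_le ?_ hr
  rw [abs_of_nonneg (by linarith : 0 ≤ n / 2 - 1), abs_le]
  constructor <;> linarith

theorem besselRatio_one {r : ℝ} (hr : 0 < r) : besselRatio 1 r = 1 := by
  rw [besselRatio, show (1 : ℝ) / 2 - 1 = -(1 / 2) by norm_num, modifiedBesselK_neg]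
  exact div_self (modifiedBesselK_pos _ hr).ne'

theorem besselRatio_three {r : ℝ} (hr : 0 < r) : besselRatio 3 r = 1 + 1 / r := by
  have hK := (modifiedBesselK_pos (1 / 2) hr).ne'
  rw [besselRatio, modifiedBesselK_half_sub_two 3 hr,
    show (3 : ℝ) / 2 - 2 = -(1 / 2) by norm_num, modifiedBesselK_neg,
    show (3 : ℝ) / 2 - 1 = 1 / 2 by norm_num]
  field_simp
  ring

/-! ### Comparison principle and monotonicity. -/

/-- A function that decreases at least at the rate `c * w` wherever it is negative, and that is
eventually bounded below, is nonnegative. -/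
theorem nonneg_of_deriv_le_mul {w w' : ℝ → ℝ} {a c M : ℝ} (hc : 0 < c)
    (hw : ∀ r, a ≤ r → HasDerivAt w (w' r) r)
    (hle : ∀ r, a ≤ r → w r < 0 → w' r ≤ c * w r) (hM : ∀ᶠ r in atTop, M ≤ w r) :
    0 ≤ w a := by
  by_contra! h0
  have hcw : c * w a < 0 := mul_neg_of_pos_of_neg hc h0
  -- Half the available slope c * w a, so that the derivative comparison at a contact point is
  -- strict.
  have key : ∀ r, a ≤ r → w r ≤ w a + c * w a / 2 * (r - a) := by
    intro r hr
    refine image_le_of_deriv_right_lt_deriv_boundary (f' := w')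
      (B := fun r => w a + c * w a / 2 * (r - a)) (B' := fun _ => c * w a / 2)
      (fun x hx => (hw x hx.1).continuousAt.continuousWithinAt)
      (fun x hx => (hw x hx.1).hasDerivWithinAt) (by simp) (fun x => ?_) (fun x hx hxB => ?_)
      (right_mem_Icc.2 hr)
    · simpa using (((hasDerivAt_id x).sub_const a).const_mul (c * w a / 2)).const_add (w a)
    · have h1 : c * w a / 2 * (x - a) ≤ 0 :=
        mul_nonpos_of_nonpos_of_nonneg (by linarith) (sub_nonneg.2 hx.1)
      have h2 : w x ≤ w a := by linarith
      have h3 := hle x hx.1 (h2.trans_lt h0)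
      have h4 : c * w x ≤ c * w a := mul_le_mul_of_nonneg_left h2 hc.le
      linarith
  have hlim : Tendsto (fun r => w a + c * w a / 2 * (r - a)) atTop atBot :=
    tendsto_atBot_add_const_left _ _ <|
      (tendsto_atTop_add_const_right _ (-a) tendsto_id).const_mul_atTop_of_neg (by linarith)
  obtain ⟨r, h1, h2, h3⟩ :=
    (hM.and ((eventually_ge_atTop a).and (hlim.eventually_lt_atBot M))).exists
  linarith [key r h2]

theorem eventually_besselRatio_le_two {n : ℝ} (hn : 1 ≤ n) :
    ∀ᶠ r in atTop, besselRatio n r ≤ 2 := by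
  filter_upwards [eventually_ge_atTop n] with r hr using besselRatio_le_two hn hr

/-- Apply the comparison principle to w = -h', using h'' = (2h - (n-1)/x) h' + (n-1)/x² h. Where h'
> 0, the equation forces h > (n-1)/x, so the factor of h' exceeds h ≥ 1. -/
theorem besselRatio_deriv_nonpos {n : ℝ} (hn : 1 ≤ n) {r : ℝ} (hr : 0 < r) :
    -1 + besselRatio n r ^ 2 - (n - 1) / r * besselRatio n r ≤ 0 := by
  set h := besselRatio n
  suffices 0 ≤ -(-1 + h r ^ 2 - (n - 1) / r * h r) by linarith
  refine nonneg_of_deriv_le_mul (w := fun x => -(-1 + h x ^ 2 - (n - 1) / x * h x))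
    (w' := fun x => -((2 * h x - (n - 1) / x) * (-1 + h x ^ 2 - (n - 1) / x * h x)
      + (n - 1) / x ^ 2 * h x)) (c := 1) (M := -3) one_pos ?_ ?_ ?_
  · intro x hx
    have hx0 : 0 < x := hr.trans_le hx
    have h1 : HasDerivAt h _ x := hasDerivAt_besselRatio n hx0
    have h2 : HasDerivAt (fun x : ℝ => (n - 1) / x) (-((n - 1) / x ^ 2)) x := by
      refine ((hasDerivAt_inv hx0.ne').const_mul (n - 1)).congr_deriv ?_
      field_simp
    refine (((h1.fun_pow 2).const_add (-1)).fun_sub (h2.fun_mul h1)).fun_neg.congr_deriv ?_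
    simp only [h]
    push_cast
    ring
  · intro x hx hneg
    have hx0 : 0 < x := hr.trans_le hx
    have h1 : 1 ≤ h x := one_le_besselRatio hn hx0
    have h2 : 0 ≤ (n - 1) / x ^ 2 * h x := by
      have : 0 ≤ n - 1 := by linarith
      positivity
    have h3 : (n - 1) / x < h x := by nlinarith
    nlinarith
  · filter_upwards [eventually_besselRatio_le_two hn, eventually_gt_atTop 0] with x h2 hx
    have h1 : 1 ≤ h x := one_le_besselRatio hn hx
    have h3 : 0 ≤ (n - 1) / x * h x := by
      have : 0 ≤ n - 1 := by linarith
      positivity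
    have h2 : h x ≤ 2 := h2
    nlinarith

theorem besselRatio_deriv_neg {n : ℝ} (hn : 1 < n) {r : ℝ} (hr : 0 < r) :
    -1 + besselRatio n r ^ 2 - (n - 1) / r * besselRatio n r < 0 := by
  refine (besselRatio_deriv_nonpos hn.le hr).lt_of_ne fun h0 => ?_
  set h := besselRatio n
  have h1 : HasDerivAt h 0 r := h0 ▸ hasDerivAt_besselRatio n hr
  have h2 : HasDerivAt (fun x : ℝ => (n - 1) / x) (-((n - 1) / r ^ 2)) r := by
    refine ((hasDerivAt_inv hr.ne').const_mul (n - 1)).congr_deriv ?_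
    field_simp
  have h3 := ((h1.fun_pow 2).const_add (-1)).fun_sub (h2.fun_mul h1)
  -- A zero of h' ≤ 0 is a maximum of h', so h'' = 0 there; but h' = 0 gives h'' = (n-1)/r² h > 0.
  have hmax : IsLocalMax (fun x => -1 + h x ^ 2 - (n - 1) / x * h x) r := by
    filter_upwards [Ioi_mem_nhds hr] with x hx
    simpa only [h0] using besselRatio_deriv_nonpos hn.le hx
  have h4 := hmax.hasDerivAt_eq_zero h3
  have h5 : 0 < (n - 1) / r ^ 2 * h r := by
    have h6 : 1 ≤ h r := one_le_besselRatio hn.le hr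
    have : 0 < n - 1 := by linarith
    positivity
  simp only [mul_zero] at h4
  linarith

theorem strictAntiOn_besselRatio {n : ℝ} (hn : 1 < n) :
    StrictAntiOn (besselRatio n) (Ioi 0) := by
  refine strictAntiOn_of_deriv_neg (convex_Ioi 0) (continuousOn_besselRatio n) fun r hr => ?_
  rw [interior_Ioi] at hr
  rw [(hasDerivAt_besselRatio n hr).deriv]
  exact besselRatio_deriv_neg hn hr

/-! ### Expansion at infinity. -/

theorem hasDerivAt_quadratic_inv (a b : ℝ) {r : ℝ} (hr : 0 < r) :
    HasDerivAt (fun x : ℝ => 1 + a / x + b / x ^ 2) (-a / r ^ 2 - 2 * b / r ^ 3) r := by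
  have h1 : HasDerivAt (fun x : ℝ => 1 + a * x⁻¹ + b * (x⁻¹) ^ 2) _ r :=
    ((((hasDerivAt_inv hr.ne').const_mul a).const_add 1).fun_add
      (((hasDerivAt_inv hr.ne').fun_pow 2).const_mul b))
  have h2 : (fun x : ℝ => 1 + a / x + b / x ^ 2) = fun x : ℝ => 1 + a * x⁻¹ + b * (x⁻¹) ^ 2 := by
    ext x
    rw [div_eq_mul_inv, div_eq_mul_inv, inv_pow]
  rw [h2]
  refine h1.congr_deriv ?_
  push_cast
  field_simp
  ring

theorem besselRatio_le_quadratic {n : ℝ} (hn : 1 ≤ n) {r : ℝ} (hr : n ≤ r) :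
    besselRatio n r ≤ 1 + (n - 1) / 2 / r + n ^ 2 / r ^ 2 := by
  suffices 0 ≤ 1 + (n - 1) / 2 / r + n ^ 2 / r ^ 2 - besselRatio n r by linarith
  set h := besselRatio n
  refine nonneg_of_deriv_le_mul (w := fun x => 1 + (n - 1) / 2 / x + n ^ 2 / x ^ 2 - h x)
    (w' := fun x => (-((n - 1) / 2) / x ^ 2 - 2 * n ^ 2 / x ^ 3)
      - (-1 + h x ^ 2 - (n - 1) / x * h x)) (c := 1) (M := -2) one_pos ?_ ?_ ?_
  · intro x hx
    have hx0 : 0 < x := by linarith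
    exact (hasDerivAt_quadratic_inv _ _ hx0).fun_sub (hasDerivAt_besselRatio n hx0)
  · intro x hx hneg
    have hx0 : 0 < x := by linarith
    have h1 : 1 ≤ h x := one_le_besselRatio hn hx0
    set g := 1 + (n - 1) / 2 / x + n ^ 2 / x ^ 2 with hg
    -- The 1/x terms cancel; the coefficient n² is large enough to make the 1/x² term nonnegative.
    have h2 : -((n - 1) / 2) / x ^ 2 - 2 * n ^ 2 / x ^ 3 ≤ -1 + g ^ 2 - (n - 1) / x * g := by
      have : -1 + g ^ 2 - (n - 1) / x * g - (-((n - 1) / 2) / x ^ 2 - 2 * n ^ 2 / x ^ 3) =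
          (2 * n ^ 2 - ((n - 1) / 2) ^ 2 + (n - 1) / 2) / x ^ 2 + 2 * n ^ 2 / x ^ 3
            + n ^ 4 / x ^ 4 := by
        rw [hg]
        field_simp
        ring
      have h3 : 0 ≤ 2 * n ^ 2 - ((n - 1) / 2) ^ 2 + (n - 1) / 2 := by nlinarith
      have h4 : 0 ≤ (2 * n ^ 2 - ((n - 1) / 2) ^ 2 + (n - 1) / 2) / x ^ 2 + 2 * n ^ 2 / x ^ 3
            + n ^ 4 / x ^ 4 := by positivity
      linarith
    have h5 : (n - 1) / x ≤ 1 := by rw [div_le_one hx0]; linarith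
    have h6 : 1 ≤ g := by
      have : 0 ≤ n - 1 := by linarith
      have : 0 ≤ (n - 1) / 2 / x + n ^ 2 / x ^ 2 := by positivity
      linarith
    -- The left side is the difference of the Riccati right-hand sides at g and at h.
    have h7 : (g - h x) * (g + h x - (n - 1) / x) ≤ (g - h x) * 1 :=
      mul_le_mul_of_nonpos_left (by linarith) hneg.le
    linarith
  · filter_upwards [eventually_besselRatio_le_two hn, eventually_gt_atTop 0] with x h2 hx
    have : 0 ≤ n - 1 := by linarith
    have : 0 ≤ (n - 1) / 2 / x + n ^ 2 / x ^ 2 := by positivity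
    have h2 : h x ≤ 2 := h2
    linarith

theorem quadratic_le_besselRatio {n : ℝ} (hn : 1 ≤ n) {r : ℝ} (hr : 4 * n ≤ r) :
    1 + (n - 1) / 2 / r + -n / r ^ 2 ≤ besselRatio n r := by
  suffices 0 ≤ besselRatio n r - (1 + (n - 1) / 2 / r + -n / r ^ 2) by linarith
  set h := besselRatio n
  refine nonneg_of_deriv_le_mul (w := fun x => h x - (1 + (n - 1) / 2 / x + -n / x ^ 2))
    (w' := fun x => (-1 + h x ^ 2 - (n - 1) / x * h x) -
      (-((n - 1) / 2) / x ^ 2 - 2 * -n / x ^ 3)) (c := 1 / 2) (M := -1 - n) one_half_pos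
      ?_ ?_ ?_
  · intro x hx
    have hx0 : 0 < x := by linarith
    exact (hasDerivAt_besselRatio n hx0).fun_sub (hasDerivAt_quadratic_inv _ _ hx0)
  · intro x hx hneg
    have hx0 : 0 < x := by linarith
    have h1 : 1 ≤ h x := one_le_besselRatio hn hx0
    set g := 1 + (n - 1) / 2 / x + -n / x ^ 2 with hg
    have h2 : -1 + g ^ 2 - (n - 1) / x * g ≤ -((n - 1) / 2) / x ^ 2 - 2 * -n / x ^ 3 := by
      have : -((n - 1) / 2) / x ^ 2 - 2 * -n / x ^ 3 - (-1 + g ^ 2 - (n - 1) / x * g) =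
          ((2 * n - (n - 1) / 2 + ((n - 1) / 2) ^ 2) * x ^ 2 + 2 * n * x - n ^ 2) / x ^ 4 := by
        rw [hg]
        field_simp
        ring
      have h3 : 0 ≤ (2 * n - (n - 1) / 2 + ((n - 1) / 2) ^ 2) * x ^ 2 := by
        have : 0 ≤ 2 * n - (n - 1) / 2 + ((n - 1) / 2) ^ 2 := by nlinarith
        positivity
      have h4 : 0 ≤ ((2 * n - (n - 1) / 2 + ((n - 1) / 2) ^ 2) * x ^ 2 + 2 * n * x - n ^ 2)
          / x ^ 4 := by
        refine div_nonneg ?_ (by positivity)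
        nlinarith
      linarith
    have h5 : (n - 1) / x ≤ 1 / 4 := by rw [div_le_iff₀ hx0]; linarith
    have h7 : (h x - g) * (h x + g - (n - 1) / x) ≤ (h x - g) * (1 / 2) :=
      mul_le_mul_of_nonpos_left (by linarith) hneg.le
    linarith
  · filter_upwards [eventually_ge_atTop n] with x hx
    have hx0 : 0 < x := by linarith
    have h1 : 1 ≤ h x := one_le_besselRatio hn hx0
    have h2 : (n - 1) / 2 / x ≤ 1 := by
      rw [div_le_one hx0]
      linarith
    have h3 : 0 ≤ n / x ^ 2 := by positivity
    rw [neg_div]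
    linarith

theorem besselRatio_sub_isBigO {n : ℝ} (hn : 1 ≤ n) :
    (fun r : ℝ => besselRatio n r - (1 + (n - 1) / (2 * r))) =O[atTop]
      (fun r : ℝ => 1 / r ^ 2) := by
  refine IsBigO.of_bound (n ^ 2) ?_
  filter_upwards [eventually_ge_atTop (4 * n)] with r hr
  have hr0 : 0 < r := by linarith
  have h1 := besselRatio_le_quadratic hn (by linarith : n ≤ r)
  have h2 := quadratic_le_besselRatio hn hr
  have h3 : n / r ^ 2 ≤ n ^ 2 / r ^ 2 := by
    gcongr
    nlinarith
  rw [neg_div] at h2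
  rw [Real.norm_of_nonneg (by positivity : 0 ≤ 1 / r ^ 2), Real.norm_eq_abs, mul_one_div,
    ← div_div, abs_le]
  constructor <;> linarith

/-! ### Behaviour at the origin. -/

theorem besselRatio_isEquivalent {n : ℝ} (hn : 3 ≤ n) :
    besselRatio n ~[𝓝[>] (0 : ℝ)] (fun r : ℝ => (n - 2) / r) := by
  have hn2 : 0 < n - 2 := by linarith
  refine isEquivalent_of_tendsto_one ?_
  have hlim : Tendsto (fun r : ℝ => 1 + r / (n - 2)) (𝓝[>] 0) (𝓝 1) := by
    have : Tendsto (fun r : ℝ => 1 + r / (n - 2)) (𝓝 0) (𝓝 (1 + 0 / (n - 2))) :=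
      (tendsto_id.div_const _).const_add 1
    simpa using this.mono_left nhdsWithin_le_nhds
  refine tendsto_of_tendsto_of_tendsto_of_le_of_le' tendsto_const_nhds hlim ?_ ?_ <;>
    filter_upwards [self_mem_nhdsWithin] with r hr
  · have hr : 0 < r := hr
    rw [Pi.div_apply, one_le_div (by positivity)]
    exact div_le_besselRatio n hr
  · have hr : 0 < r := hr
    rw [Pi.div_apply, div_le_iff₀ (by positivity)]
    refine (besselRatio_le_one_add_div hn hr).trans_eq ?_
    field_simp
    ring

theorem hasDerivAt_inv_mul_besselRatio_two_add_log {r : ℝ} (hr : 0 < r) :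
    HasDerivAt (fun x => (x * besselRatio 2 x)⁻¹ + Real.log x)
      (r * (r * besselRatio 2 r)⁻¹ ^ 2) r := by
  have h1 : 0 < besselRatio 2 r := one_pos.trans_le (one_le_besselRatio one_le_two hr)
  have h2 := (((hasDerivAt_id' r).fun_mul (hasDerivAt_besselRatio 2 hr)).fun_inv
    (mul_pos hr h1).ne').fun_add (Real.hasDerivAt_log hr.ne')
  refine h2.congr_deriv ?_
  field_simp
  ring

/-- With z = 1/(r h), the function z + log r has derivative r z² ≥ 0. Monotonicity gives z ≤ z(1) -
log r, hence r z² is bounded on (0, 1], and integrating this bound gives the lower one. -/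
theorem exists_bounds_inv_mul_besselRatio_two_add_log :
    ∃ m M : ℝ, ∀ r ∈ Ioo (0 : ℝ) 1, (r * besselRatio 2 r)⁻¹ + Real.log r ∈ Icc m M := by
  set z : ℝ → ℝ := fun r => (r * besselRatio 2 r)⁻¹ with hz
  have hzpos : ∀ r, 0 < r → 0 < z r := fun r hr =>
    inv_pos.2 (mul_pos hr (one_pos.trans_le (one_le_besselRatio one_le_two hr)))
  have hd : ∀ r, 0 < r → HasDerivAt (fun x => z x + Real.log x) (r * z r ^ 2) r :=
    fun r hr => hasDerivAt_inv_mul_besselRatio_two_add_log hr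
  have hcont : ContinuousOn (fun x => z x + Real.log x) (Ioc 0 1) := fun r hr =>
    (hd r hr.1).continuousAt.continuousWithinAt
  have hmono : MonotoneOn (fun x => z x + Real.log x) (Ioc 0 1) := by
    refine monotoneOn_of_deriv_nonneg (convex_Ioc 0 1) hcont (fun r hr => ?_) fun r hr => ?_ <;>
      rw [interior_Ioc] at hr
    · exact (hd r hr.1).differentiableAt.differentiableWithinAt
    · rw [(hd r hr.1).deriv]
      have := hr.1
      positivity
  have hup : ∀ r ∈ Ioc (0 : ℝ) 1, z r + Real.log r ≤ z 1 := fun r hr => by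
    simpa using hmono hr (right_mem_Ioc.2 one_pos) hr.2
  have hquad : ∀ r ∈ Ioc (0 : ℝ) 1, r * z r ^ 2 ≤ (z 1 + 2) ^ 2 := by
    intro r hr
    have hs : 0 < √r := Real.sqrt_pos.2 hr.1
    have hs1 : √r ≤ 1 := Real.sqrt_le_one.2 hr.2
    -- From log s ≥ 1 - 1/s at s = √r.
    have hlog : -Real.log r ≤ 2 / √r := by
      have h1 := Real.one_sub_inv_le_log_of_pos hs
      rw [Real.log_sqrt hr.1.le] at h1
      rw [div_eq_mul_inv]
      linarith
    have h1 : √r * z r ≤ z 1 + 2 := by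
      have h2 : z r ≤ z 1 + 2 / √r := by linarith [hup r hr]
      calc √r * z r ≤ √r * (z 1 + 2 / √r) := by gcongr
        _ = √r * z 1 + 2 := by field_simp
        _ ≤ 1 * z 1 + 2 := by gcongr; exact (hzpos 1 one_pos).le
        _ = z 1 + 2 := by ring
    have h3 : r * z r ^ 2 = (√r * z r) ^ 2 := by rw [mul_pow, Real.sq_sqrt hr.1.le]
    rw [h3]
    have := hzpos r hr.1
    gcongr
  have hanti : AntitoneOn (fun x => z x + Real.log x - (z 1 + 2) ^ 2 * x) (Ioc 0 1) := by
    have hd' : ∀ r, 0 < r → HasDerivAt (fun x => z x + Real.log x - (z 1 + 2) ^ 2 * x)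
        (r * z r ^ 2 - (z 1 + 2) ^ 2 * 1) r := fun r hr =>
      (hd r hr).fun_sub ((hasDerivAt_id' r).const_mul _)
    refine antitoneOn_of_deriv_nonpos (convex_Ioc 0 1)
      (fun r hr => (hd' r hr.1).continuousAt.continuousWithinAt) (fun r hr => ?_)
      fun r hr => ?_ <;> rw [interior_Ioc] at hr
    · exact (hd' r hr.1).differentiableAt.differentiableWithinAt
    · rw [(hd' r hr.1).deriv]
      linarith [hquad r ⟨hr.1, hr.2.le⟩]
  refine ⟨z 1 - (z 1 + 2) ^ 2, z 1, fun r hr => ⟨?_, hup r ⟨hr.1, hr.2.le⟩⟩⟩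
  have h1 := hanti ⟨hr.1, hr.2.le⟩ (right_mem_Ioc.2 one_pos) hr.2.le
  simp only [Real.log_one, add_zero, mul_one] at h1
  have h2 : 0 ≤ (z 1 + 2) ^ 2 * r := mul_nonneg (sq_nonneg _) hr.1.le
  change z 1 - (z 1 + 2) ^ 2 ≤ z r + Real.log r
  linarith

theorem besselRatio_two_isEquivalent :
    besselRatio 2 ~[𝓝[>] (0 : ℝ)] (fun r : ℝ => 1 / (r * Real.log (1 / r))) := by
  obtain ⟨m, M, hmM⟩ := exists_bounds_inv_mul_besselRatio_two_add_log
  have hlog : Tendsto (fun r : ℝ => Real.log (1 / r)) (𝓝[>] 0) atTop := by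
    simp only [one_div]
    exact Real.tendsto_log_atTop.comp tendsto_inv_nhdsGT_zero
  have hbdd : (fun r => (r * besselRatio 2 r)⁻¹ + Real.log r) =O[𝓝[>] (0 : ℝ)]
      (fun _ => (1 : ℝ)) := by
    refine IsBigO.of_bound (max |m| |M|) ?_
    filter_upwards [Ioo_mem_nhdsGT one_pos] with r hr
    rw [norm_one, mul_one]
    exact abs_le_max_abs_abs (hmM r hr).1 (hmM r hr).2
  have hsmall : (fun r => (r * besselRatio 2 r)⁻¹ + Real.log r) =o[𝓝[>] (0 : ℝ)]
      (fun r => Real.log (1 / r)) :=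
    hbdd.trans_isLittleO (isLittleO_const_left.2 (Or.inr (tendsto_norm_atTop_atTop.comp hlog)))
  have hz : (fun r => (r * besselRatio 2 r)⁻¹) ~[𝓝[>] (0 : ℝ)] (fun r => Real.log (1 / r)) := by
    refine (IsEquivalent.refl.add_isLittleO hsmall).congr_left (Eventually.of_forall fun r => ?_)
    simp
  have hid : (fun r : ℝ => r) ~[𝓝[>] (0 : ℝ)] (fun r => r) := IsEquivalent.refl
  refine ((hid.mul hz).inv.congr_left ?_).congr_right (Eventually.of_forall fun r => ?_)
  · filter_upwards [self_mem_nhdsWithin] with r hr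
    have hr : 0 < r := hr
    simp only [Pi.inv_apply, Pi.mul_apply, mul_inv, inv_inv]
    field_simp
  · simp

/-! ### General solution of the Riccati equation. -/

theorem eq_zero_of_hasDerivWithinAt_mul {ψ a : ℝ → ℝ} {J : Set ℝ} (hJ : J.OrdConnected)
    (ha : ContinuousOn a J) (hψ : ∀ r ∈ J, HasDerivWithinAt ψ (a r * ψ r) J r) {r₁ : ℝ}
    (h₁ : r₁ ∈ J) (h0 : ψ r₁ = 0) : ∀ r ∈ J, ψ r = 0 := by
  have lip : ∀ x ∈ J, ∀ y ∈ J, ∃ K : NNReal, ∀ t ∈ Icc x y,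
      LipschitzOnWith K (fun z => a t * z) univ := by
    intro x hx y hy
    obtain ⟨K, hK⟩ := isCompact_Icc.exists_bound_of_continuousOn (ha.mono (hJ.out hx hy))
    refine ⟨K.toNNReal, fun t ht => (LipschitzWith.of_dist_le_mul fun u v => ?_).lipschitzOnWith⟩
    rw [dist_eq_norm, dist_eq_norm, ← mul_sub, norm_mul]
    gcongr
    exact (hK t ht).trans (Real.le_coe_toNNReal K)
  have hcont : ContinuousOn ψ J := fun r hr => (hψ r hr).continuousWithinAt
  have hzero : ∀ (s : Set ℝ) (t : ℝ), HasDerivWithinAt (fun _ => (0 : ℝ)) (a t * 0) s t := by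
    intro s t
    rw [mul_zero]
    exact hasDerivWithinAt_const _ _ _
  intro r hr
  rcases le_total r₁ r with h | h
  · obtain ⟨K, hK⟩ := lip r₁ h₁ r hr
    have hsub := hJ.out h₁ hr
    refine ODE_solution_unique_of_mem_Icc_right (v := fun t z => a t * z) (s := fun _ => univ)
      (g := fun _ => 0) (fun t ht => hK t ⟨ht.1, ht.2.le⟩) (hcont.mono hsub)
      (fun t ht => ?_) (fun _ _ => mem_univ _) continuousOn_const (fun t _ => hzero _ t)
      (fun _ _ => mem_univ _) h0 (right_mem_Icc.2 h)
    exact (hψ t (hsub ⟨ht.1, ht.2.le⟩)).mono_of_mem_nhdsWithin <|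
      mem_of_superset (Icc_mem_nhdsGE ht.2) ((Icc_subset_Icc_left ht.1).trans hsub)
  · obtain ⟨K, hK⟩ := lip r hr r₁ h₁
    have hsub := hJ.out hr h₁
    refine ODE_solution_unique_of_mem_Icc_left (v := fun t z => a t * z) (s := fun _ => univ)
      (g := fun _ => 0) (fun t ht => hK t ⟨ht.1.le, ht.2⟩) (hcont.mono hsub)
      (fun t ht => ?_) (fun _ _ => mem_univ _) continuousOn_const (fun t _ => hzero _ t)
      (fun _ _ => mem_univ _) h0 (left_mem_Icc.2 h)
    exact (hψ t (hsub ⟨ht.1.le, ht.2⟩)).mono_of_mem_nhdsWithin <|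
      mem_of_superset (Icc_mem_nhdsLE ht.1) ((Icc_subset_Icc_right ht.2).trans hsub)

/-- The weight `1 / (r K_{n/2-1}(r)^2)`, the integrating factor of the Riccati equation
linearized around `besselRatio n`. -/
noncomputable def besselWeight (n r : ℝ) : ℝ := (r * modifiedBesselK (n / 2 - 1) r ^ 2)⁻¹

theorem besselWeight_pos (n : ℝ) {r : ℝ} (hr : 0 < r) : 0 < besselWeight n r :=
  inv_pos.2 (mul_pos hr (pow_pos (modifiedBesselK_pos _ hr) 2))

theorem hasDerivAt_besselWeight (n : ℝ) {r : ℝ} (hr : 0 < r) :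
    HasDerivAt (besselWeight n)
      ((2 * besselRatio n r - (n - 1) / r) * besselWeight n r) r := by
  have hK := modifiedBesselK_pos (n / 2 - 1) hr
  refine (((hasDerivAt_id' r).fun_mul
    ((hasDerivAt_modifiedBesselK_half_sub_one n hr).fun_pow 2)).fun_inv
      (mul_pos hr (pow_pos hK 2)).ne').congr_deriv ?_
  rw [besselWeight, besselRatio]
  generalize modifiedBesselK (n / 2 - 1) r = b at hK ⊢
  push_cast
  field_simp
  ring

theorem continuousOn_besselWeight (n : ℝ) : ContinuousOn (besselWeight n) (Ioi 0) :=
  fun _ hr => (hasDerivAt_besselWeight n hr).continuousAt.continuousWithinAt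

theorem hasDerivAt_integral_besselWeight (n : ℝ) {r₁ r : ℝ} (hr₁ : 0 < r₁) (hr : 0 < r) :
    HasDerivAt (fun x => ∫ t in r₁..x, besselWeight n t) (besselWeight n r) r := by
  refine intervalIntegral.integral_hasDerivAt_right ?_ ?_
    (hasDerivAt_besselWeight n hr).continuousAt
  · refine ((continuousOn_besselWeight n).mono fun t ht => ?_).intervalIntegrable
    exact (lt_min hr₁ hr).trans_le ht.1
  · exact (continuousOn_besselWeight n).stronglyMeasurableAtFilter isOpen_Ioi r hr

theorem strictMonoOn_integral_besselWeight (n : ℝ) {r₁ : ℝ} (hr₁ : 0 < r₁) :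
    StrictMonoOn (fun x => ∫ t in r₁..x, besselWeight n t) (Ioi 0) := by
  refine strictMonoOn_of_deriv_pos (convex_Ioi 0) (fun r hr =>
    (hasDerivAt_integral_besselWeight n hr₁ hr).continuousAt.continuousWithinAt) fun r hr => ?_
  rw [interior_Ioi] at hr
  rw [(hasDerivAt_integral_besselWeight n hr₁ hr).deriv]
  exact besselWeight_pos n hr

theorem monotoneOn_besselWeight {n : ℝ} (hn : 1 ≤ n) : MonotoneOn (besselWeight n) (Ici n) := by
  have hpos : ∀ r ∈ Ici n, 0 < r := fun r hr => by
    have : n ≤ r := hr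
    linarith
  refine monotoneOn_of_deriv_nonneg (convex_Ici n)
    ((continuousOn_besselWeight n).mono hpos) (fun r hr => ?_) fun r hr => ?_ <;>
      have hr0 := hpos r (interior_subset hr)
  · exact (hasDerivAt_besselWeight n hr0).differentiableAt.differentiableWithinAt
  · rw [(hasDerivAt_besselWeight n hr0).deriv]
    refine mul_nonneg ?_ (besselWeight_pos n hr0).le
    have h1 : (n - 1) / r ≤ 1 := by
      have : n ≤ r := interior_subset hr
      rw [div_le_one hr0]
      linarith
    linarith [one_le_besselRatio hn hr0]

theorem exists_integral_besselWeight_eq {n : ℝ} (hn : 1 ≤ n) {r₁ C : ℝ} (hr₁ : 0 < r₁)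
    (hC : 0 < C) : ∃ R, r₁ < R ∧ ∫ t in r₁..R, besselWeight n t = C := by
  set F : ℝ → ℝ := fun x => ∫ t in r₁..x, besselWeight n t with hF
  have hF1 : F r₁ = 0 := intervalIntegral.integral_same
  have hd : ∀ r, 0 < r → HasDerivAt F (besselWeight n r) r := fun r hr =>
    hasDerivAt_integral_besselWeight n hr₁ hr
  set m := max n r₁ with hm
  have hm0 : 0 < m := hr₁.trans_le (le_max_right _ _)
  have hE := besselWeight_pos n hm0
  -- The weight is increasing beyond m, so a rectangle of area C fits under its graph over [m, b].
  set b := m + C / besselWeight n m with hb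
  have hmb : m ≤ b := le_add_of_nonneg_right (by positivity)
  have hgrow : besselWeight n m * (b - m) ≤ F b - F m := by
    refine (convex_Icc m b).mul_sub_le_image_sub_of_le_deriv
      (fun r hr => (hd r (hm0.trans_le hr.1)).continuousAt.continuousWithinAt)
      (fun r hr => ?_) (fun r hr => ?_) m (left_mem_Icc.2 hmb) b (right_mem_Icc.2 hmb) hmb <;>
        have hr' := interior_subset hr
    · exact (hd r (hm0.trans_le hr'.1)).differentiableAt.differentiableWithinAt
    · rw [(hd r (hm0.trans_le hr'.1)).deriv]
      exact monotoneOn_besselWeight hn (le_max_left _ _ : n ≤ m)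
        ((le_max_left n r₁).trans hr'.1) hr'.1
  have hFm : 0 ≤ F m := hF1 ▸ (strictMonoOn_integral_besselWeight n hr₁).monotoneOn hr₁ hm0
    (le_max_right _ _)
  have hbm : besselWeight n m * (b - m) = C := by
    rw [hb]
    field_simp
    ring
  obtain ⟨R, hR, hRC⟩ := intermediate_value_Icc ((le_max_right n r₁).trans hmb)
    (fun r hr => (hd r (hr₁.trans_le hr.1)).continuousAt.continuousWithinAt)
    (show C ∈ Icc (F r₁) (F b) from ⟨by linarith, by linarith⟩)
  refine ⟨R, hR.1.lt_of_ne ?_, hRC⟩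
  rintro rfl
  linarith

/-- The difference of the two sides solves ψ' = (H + h - (N-1)/r) ψ and vanishes at r₁. The product
form avoids dividing by H - h or by C - ∫E. -/
theorem sub_besselRatio_mul_eq {N : ℕ} {H : ℝ → ℝ} {J : Set ℝ} (hJ : J.OrdConnected)
    (hJ0 : J ⊆ Ioi 0) (hH : IsRiccatiSolutionOn N H J) {r₁ C : ℝ} (h₁ : r₁ ∈ J)
    (hC : (H r₁ - besselRatio N r₁) * C = besselWeight N r₁) :
    ∀ r ∈ J, (H r - besselRatio N r) * (C - ∫ t in r₁..r, besselWeight N t) =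
      besselWeight N r := by
  intro r hr
  rw [← sub_eq_zero]
  have hcH : ContinuousOn H J := fun x hx => (hH x hx).continuousWithinAt
  have hch : ContinuousOn (besselRatio N) J := (continuousOn_besselRatio N).mono hJ0
  refine eq_zero_of_hasDerivWithinAt_mul (a := fun r => H r + besselRatio N r - (N - 1) / r)
    (ψ := fun r => (H r - besselRatio N r) * (C - ∫ t in r₁..r, besselWeight N t) -
      besselWeight N r) hJ ?_ ?_ h₁ ?_ r hr
  · exact (hcH.add hch).sub (continuousOn_const.div continuousOn_id fun x hx => (hJ0 hx).ne')
  · intro x hx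
    have hx0 : 0 < x := hJ0 hx
    refine ((((hH x hx).fun_sub (hasDerivAt_besselRatio N hx0).hasDerivWithinAt).fun_mul
      ((hasDerivAt_integral_besselWeight N (hJ0 h₁) hx0).hasDerivWithinAt.const_sub C)).fun_sub
        (hasDerivAt_besselWeight N hx0).hasDerivWithinAt).congr_deriv ?_
    ring
  · simp [hC]

theorem hasDerivAt_besselRatio_add_div {n : ℝ} {r₁ C r : ℝ} (hr₁ : 0 < r₁) (hr : 0 < r)
    (hC : C - (∫ t in r₁..r, besselWeight n t) ≠ 0) :
    HasDerivAt (fun x => besselRatio n x +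
        besselWeight n x / (C - ∫ t in r₁..x, besselWeight n t))
      (-1 + (besselRatio n r + besselWeight n r / (C - ∫ t in r₁..r, besselWeight n t)) ^ 2 -
        (n - 1) / r *
          (besselRatio n r + besselWeight n r / (C - ∫ t in r₁..r, besselWeight n t))) r := by
  refine ((hasDerivAt_besselRatio n hr).fun_add ((hasDerivAt_besselWeight n hr).fun_div
    ((hasDerivAt_integral_besselWeight n hr₁ hr).const_sub C) hC)).congr_deriv ?_
  generalize C - (∫ t in r₁..r, besselWeight n t) = D at hC ⊢
  field_simp
  ring

theorem eq_besselRatio_add_div {n x H D : ℝ} (hx : 0 < x)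
    (h : (H - besselRatio n x) * D = besselWeight n x) :
    besselRatio n x + besselWeight n x / D = H := by
  have hD : D ≠ 0 := by
    rintro rfl
    rw [mul_zero] at h
    exact (besselWeight_pos n hx).ne h
  rw [← h, mul_div_cancel_right₀ _ hD]
  ring

/-! ### Solutions above and below the Bessel ratio; uniqueness. -/

theorem blowUp_of_besselRatio_lt {N : ℕ} (hN : 1 ≤ N) {H : ℝ → ℝ} {J : Set ℝ}
    (hmax : IsForwardMaximalRiccatiSolution N H J) {r₁ : ℝ} (h₁ : r₁ ∈ J)
    (hlt : besselRatio N r₁ < H r₁) : ∃ R : ℝ, IsLUB J R ∧ Tendsto H (𝓝[<] R) atTop := by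
  obtain ⟨hJ, hJ0, hH, hext⟩ := hmax
  have hr₁ : 0 < r₁ := hJ0 h₁
  have hw : 0 < H r₁ - besselRatio N r₁ := sub_pos.2 hlt
  set C := besselWeight N r₁ / (H r₁ - besselRatio N r₁) with hCdef
  have hCpos : 0 < C := div_pos (besselWeight_pos _ hr₁) hw
  obtain ⟨R, hR, hRC⟩ := exists_integral_besselWeight_eq (n := N) (by exact_mod_cast hN) hr₁ hCpos
  have hR0 : 0 < R := hr₁.trans hR
  have hrep := sub_besselRatio_mul_eq hJ hJ0 hH h₁ (mul_div_cancel₀ _ hw.ne')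
  have hFlt : ∀ x ∈ Ioo 0 R, ∫ t in r₁..x, besselWeight N t < C := fun x hx =>
    hRC ▸ strictMonoOn_integral_besselWeight N hr₁ hx.1 hR0 hx.2
  -- At R the product identity would read 0 = E(R) > 0.
  have hJR : J ⊆ Ioo 0 R := by
    refine fun x hx => ⟨hJ0 hx, ?_⟩
    by_contra! hRx
    have h := hrep R (hJ.out h₁ hx ⟨hR.le, hRx⟩)
    rw [hRC, sub_self, mul_zero] at h
    exact (besselWeight_pos _ hR0).ne h
  have hEq : EqOn (fun x => besselRatio N x +
      besselWeight N x / (C - ∫ t in r₁..x, besselWeight N t)) H J := fun x hx =>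
    eq_besselRatio_add_div (hJ0 hx) (hrep x hx)
  -- The explicit formula continues H up to R, so by maximality J comes arbitrarily close to R.
  have hcof := hext _ (Ioo 0 R) ordConnected_Ioo (fun x hx => hx.1) hJR hEq fun x hx =>
    (hasDerivAt_besselRatio_add_div hr₁ hx.1 (sub_pos.2 (hFlt x hx)).ne').hasDerivWithinAt
  refine ⟨R, ⟨fun x hx => (hJR hx).2.le, fun b hb => ?_⟩, ?_⟩
  · by_contra! hbR
    obtain ⟨x, hbx, hxR⟩ := exists_between hbR
    obtain ⟨y, hy, hxy⟩ := hcof x ⟨(hr₁.trans_le (hb h₁)).trans hbx, hxR⟩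
    exact (hbx.trans_le hxy).not_ge (hb hy)
  · have hd := hasDerivAt_integral_besselWeight N hr₁ hR0
    have hlim : Tendsto (fun x => C - ∫ t in r₁..x, besselWeight N t) (𝓝[<] R) (𝓝[>] 0) := by
      refine tendsto_nhdsWithin_iff.2 ⟨?_, ?_⟩
      · have := (hd.continuousAt.tendsto.const_sub C).mono_left
          (nhdsWithin_le_nhds (s := Iio R))
        rwa [hRC, sub_self] at this
      · filter_upwards [Ioo_mem_nhdsLT hR0] with x hx using sub_pos.2 (hFlt x hx)
    have hE : Tendsto (besselWeight N) (𝓝[<] R) (𝓝 (besselWeight N R)) :=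
      (hasDerivAt_besselWeight N hR0).continuousAt.tendsto.mono_left nhdsWithin_le_nhds
    have hh : Tendsto (besselRatio N) (𝓝[<] R) (𝓝 (besselRatio N R)) :=
      (hasDerivAt_besselRatio N hR0).continuousAt.tendsto.mono_left nhdsWithin_le_nhds
    refine (hh.add_atTop (hE.pos_mul_atTop (besselWeight_pos _ hR0)
      (tendsto_inv_nhdsGT_zero.comp hlim))).congr' ?_
    filter_upwards [Ioo_mem_nhdsLT hR] with x hx
    obtain ⟨y, hy, hxy⟩ := hcof x ⟨hr₁.trans hx.1, hx.2⟩
    exact hEq (hJ.out h₁ hy ⟨hx.1.le, hxy⟩)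

theorem exists_neg_of_lt_besselRatio {N : ℕ} (hN : 1 ≤ N) {H : ℝ → ℝ} {J : Set ℝ}
    (hmax : IsForwardMaximalRiccatiSolution N H J) {r₁ : ℝ} (h₁ : r₁ ∈ J)
    (hlt : H r₁ < besselRatio N r₁) : ∃ r ∈ J, r₁ < r ∧ H r < 0 := by
  obtain ⟨hJ, hJ0, hH, hext⟩ := hmax
  have hn : (1 : ℝ) ≤ N := by exact_mod_cast hN
  have hr₁ : 0 < r₁ := hJ0 h₁
  have hw : H r₁ - besselRatio N r₁ < 0 := sub_neg.2 hlt
  set C := besselWeight N r₁ / (H r₁ - besselRatio N r₁) with hCdef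
  have hCneg : C < 0 := div_neg_of_pos_of_neg (besselWeight_pos _ hr₁) hw
  set F : ℝ → ℝ := fun x => ∫ t in r₁..x, besselWeight N t with hF
  have hmono : StrictMonoOn F (Ioi 0) := strictMonoOn_integral_besselWeight N hr₁
  have hF1 : F r₁ = 0 := intervalIntegral.integral_same
  have hrep : ∀ r ∈ J, (H r - besselRatio N r) * (C - F r) = besselWeight N r :=
    sub_besselRatio_mul_eq hJ hJ0 hH h₁ (mul_div_cancel₀ _ hw.ne)
  have hright : ∀ x, r₁ ≤ x → C < F x := fun x hx =>
    hCneg.trans_le (hF1 ▸ hmono.monotoneOn hr₁ (hr₁.trans_le hx) hx)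
  -- The formula may have a pole to the left of r₁, which J cannot cross.
  have hJF : J ⊆ {x | 0 < x ∧ C < F x} := by
    refine fun x hx => ⟨hJ0 hx, ?_⟩
    by_contra! hxC
    have hxr : x ≤ r₁ := by
      by_contra! h
      exact (hright x h.le).not_ge hxC
    obtain ⟨s, hs, hsC⟩ := intermediate_value_Icc hxr (fun r hr =>
      (hasDerivAt_integral_besselWeight N hr₁
        ((hJ0 hx).out.trans_le hr.1)).continuousAt.continuousWithinAt)
      (show C ∈ Icc (F x) (F r₁) from ⟨hxC, by linarith⟩)
    have hsJ : s ∈ J := hJ.out hx h₁ hs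
    have h := hrep s hsJ
    rw [show F s = C from hsC, sub_self, mul_zero] at h
    exact (besselWeight_pos _ (hJ0 hsJ)).ne h
  have hcof := hext (fun x => besselRatio N x + besselWeight N x / (C - F x))
    {x | 0 < x ∧ C < F x}
    ⟨fun x hx y _ z hz => ⟨hx.1.trans_le hz.1,
      hx.2.trans_le (hmono.monotoneOn hx.1 (hx.1.trans_le hz.1) hz.1)⟩⟩
    (fun x hx => hx.1) hJF (fun x hx => eq_besselRatio_add_div (hJ0 hx) (hrep x hx))
    fun x hx => (hasDerivAt_besselRatio_add_div hr₁ hx.1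
      (sub_neg.2 hx.2).ne).hasDerivWithinAt
  have hJr : ∀ x, r₁ ≤ x → x ∈ J := fun x hx => by
    obtain ⟨y, hy, hxy⟩ := hcof x ⟨hr₁.trans_le hx, hright x hx⟩
    exact hJ.out h₁ hy ⟨hx, hxy⟩
  by_contra! hpos
  have hpos' : ∀ x, r₁ < x → 0 ≤ H x := fun x hx => hpos x (hJr x hx.le) hx
  -- Beyond 2N one has (N-1)/x ≤ 1/2, so H ≥ 0 and h ≥ 1 give the rate H + h - (N-1)/x ≥ 1/2.
  set a := r₁ + 2 * N with ha
  have har : ∀ x, a ≤ x → r₁ < x ∧ 2 * (N : ℝ) ≤ x := fun x hx => by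
    constructor <;> linarith
  have hwa : 0 ≤ H a - besselRatio N a := by
    refine nonneg_of_deriv_le_mul (w := fun x => H x - besselRatio N x)
      (w' := fun x => (-1 + H x ^ 2 - ((N : ℝ) - 1) / x * H x) -
        (-1 + besselRatio N x ^ 2 - ((N : ℝ) - 1) / x * besselRatio N x))
      (c := 1 / 2) (M := -2) one_half_pos ?_ ?_ ?_
    · intro x hx
      have hx1 := (har x hx).1
      exact ((hH x (hJr x hx1.le)).hasDerivAt (mem_of_superset (Ioi_mem_nhds hx1)
        fun y hy => hJr y (le_of_lt hy))).fun_sub (hasDerivAt_besselRatio N (hr₁.trans hx1))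
    · intro x hx hneg
      obtain ⟨hx1, hx2⟩ := har x hx
      have hx0 := hr₁.trans hx1
      have h1 := one_le_besselRatio hn hx0
      have h2 := hpos' x hx1
      have h3 : ((N : ℝ) - 1) / x ≤ 1 / 2 := by
        rw [div_le_iff₀ hx0]
        linarith
      have h4 : (H x - besselRatio N x) * (H x + besselRatio N x - ((N : ℝ) - 1) / x) ≤
          (H x - besselRatio N x) * (1 / 2) :=
        mul_le_mul_of_nonpos_left (by linarith) hneg.le
      linarith
    · filter_upwards [eventually_besselRatio_le_two hn, eventually_gt_atTop r₁] with x h2 hx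
      linarith [hpos' x hx]
  have ha1 : r₁ ≤ a := (har a le_rfl).1.le
  have h := hrep a (hJr a ha1)
  -- This contradicts the product identity, whose right side is positive.
  have h2 : (H a - besselRatio N a) * (C - F a) ≤ 0 :=
    mul_nonpos_of_nonneg_of_nonpos hwa (by linarith [hright a ha1])
  linarith [besselWeight_pos N (hr₁.trans_le ha1)]

theorem isPositiveRiccatiSolution_besselRatio {N : ℕ} (hN : 1 ≤ N) :
    IsPositiveRiccatiSolution N (besselRatio N) :=
  ⟨fun _ hr => (hasDerivAt_besselRatio N hr).hasDerivWithinAt, fun _ hr =>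
    one_pos.trans_le (one_le_besselRatio (by exact_mod_cast hN) hr)⟩

theorem IsPositiveRiccatiSolution.isForwardMaximal {N : ℕ} {g : ℝ → ℝ}
    (hg : IsPositiveRiccatiSolution N g) : IsForwardMaximalRiccatiSolution N g (Ioi 0) :=
  ⟨ordConnected_Ioi, subset_rfl, hg.1, fun _ _ _ hJ' _ _ _ x hx => ⟨x, hJ' hx, le_rfl⟩⟩

theorem IsPositiveRiccatiSolution.eqOn_besselRatio {N : ℕ} (hN : 1 ≤ N) {g : ℝ → ℝ}
    (hg : IsPositiveRiccatiSolution N g) : EqOn g (besselRatio N) (Ioi 0) := by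
  intro r hr
  rcases lt_trichotomy (g r) (besselRatio N r) with h | h | h
  · obtain ⟨x, hx, -, hneg⟩ := exists_neg_of_lt_besselRatio hN hg.isForwardMaximal hr h
    exact absurd (hg.2 x hx) hneg.not_gt
  · exact h
  · obtain ⟨R, hR, -⟩ := blowUp_of_besselRatio_lt hN hg.isForwardMaximal hr h
    exact absurd ⟨R, hR.1⟩ (not_bddAbove_Ioi 0)

theorem lemma3p2 (N : ℕ) (hN : 1 ≤ N) :
    ∃ h : ℝ → ℝ,
      -- existence and uniqueness of the positive solution on `(0, ∞)`
      IsPositiveRiccatiSolution N h ∧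
      (∀ g : ℝ → ℝ, IsPositiveRiccatiSolution N g → EqOn g h (Ioi 0)) ∧
      -- monotonicity and asymptotic behaviour
      (2 ≤ N → StrictAntiOn h (Ioi 0) ∧
        (fun r : ℝ => h r - (1 + ((N : ℝ) - 1) / (2 * r))) =O[atTop] (fun r : ℝ => 1 / r ^ 2)) ∧
      (N = 2 → h ~[𝓝[>] (0 : ℝ)] (fun r : ℝ => 1 / (r * Real.log (1 / r)))) ∧
      (3 ≤ N → h ~[𝓝[>] (0 : ℝ)] (fun r : ℝ => ((N : ℝ) - 2) / r)) ∧
      -- solutions above `h` blow up to `+∞` at a finite point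
      (∀ (H : ℝ → ℝ) (J : Set ℝ), IsForwardMaximalRiccatiSolution N H J →
        ∀ r₁ ∈ J, h r₁ < H r₁ → ∃ R : ℝ, IsLUB J R ∧ Tendsto H (𝓝[<] R) atTop) ∧
      -- solutions below `h` do not stay positive
      (∀ (H : ℝ → ℝ) (J : Set ℝ), IsForwardMaximalRiccatiSolution N H J →
        ∀ r₁ ∈ J, H r₁ < h r₁ → ∃ r ∈ J, r₁ < r ∧ H r < 0) ∧
      -- explicit formula
      (∀ r : ℝ, 0 < r →
        h r = modifiedBesselK ((N : ℝ) / 2) r / modifiedBesselK ((N : ℝ) / 2 - 1) r) ∧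
      (N = 1 → ∀ r : ℝ, 0 < r → h r = 1) ∧
      (N = 3 → ∀ r : ℝ, 0 < r → h r = 1 + 1 / r) := by
  have hn : (1 : ℝ) ≤ N := by exact_mod_cast hN
  refine ⟨besselRatio N, isPositiveRiccatiSolution_besselRatio hN,
    fun g hg => hg.eqOn_besselRatio hN,
    fun h2 => ⟨strictAntiOn_besselRatio (by exact_mod_cast h2), besselRatio_sub_isBigO hn⟩,
    ?_, fun h3 => besselRatio_isEquivalent (by exact_mod_cast h3),
    fun H J hmax r₁ h₁ hlt => blowUp_of_besselRatio_lt hN hmax h₁ hlt,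
    fun H J hmax r₁ h₁ hlt => exists_neg_of_lt_besselRatio hN hmax h₁ hlt,
    fun r _ => rfl, ?_, ?_⟩
  · rintro rfl
    exact_mod_cast besselRatio_two_isEquivalent
  · rintro rfl r hr
    exact_mod_cast besselRatio_one hr
  · rintro rfl r hr
    exact_mod_cast besselRatio_three hr
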